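/- For a nonzero polynomial $p$ over $\mathbb{C}$ in finitely many variables, write $p = c\,p_1^{e_1} p_2^{e_2}\cdots p_s^{e_s}$ with $c \in \mathbb{C}^*$, all $p_i$ irreducible and pairwise relatively prime, and all $e_i \ge 1$, and let $r(p) := \deg(p_1 p_2 \cdots p_s)$ be the degree of the square-free part of $p$, where $\deg$ denotes the total degree. **Theorem.** Let $n \ge 3$ and let $f_1, f_2, \ldots, f_n$ be (possibly multivariate) polynomials over $\mathbb{C}$, not all constant, such that $$f_1 + f_2 + \cdots + f_n = 0.$$ Assume furthermore that for all $s \ge 1$ and all $1 \le i_1 < i_2 < \cdots < i_s \le n$, $$f_{i_1} + f_{i_2} + \cdots + f_{i_s} = 0 \Longrightarrow \gcd\{f_{i_1}, f_{i_2}, \ldots, f_{i_s}\} = 1$$ (in particular, by the case $s = 1$, no $f_i$ is zero). Then $$\max_{1 \le m \le n} \deg f_m \le \frac{(n-1)(n-2)}{2}\Big(r(f_1 f_2 \cdots f_n) - 1\Big).$$ -/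

import Mathlib

open MvPolynomial

/-- The square-free part `p₁ p₂ ⋯ pₛ` of a polynomial `p = p₁^e₁ p₂^e₂ ⋯ pₛ^eₛ` over `ℂ`, where
the `pᵢ` are irreducible and pairwise relatively prime and `eᵢ ≥ 1`. It is determined up to a
nonzero constant; here the `pᵢ` are representatives of their classes up to
nonzero constants, chosen once and for all. -/
noncomputable def squarefreePart {σ : Type*} (p : MvPolynomial σ ℂ) : MvPolynomial σ ℂ :=
  letI : StrongNormalizationMonoid (MvPolynomial σ ℂ) :=
    UniqueFactorizationMonoid.strongNormalizationMonoid
  UniqueFactorizationMonoid.radical p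

/-- `r(p)`: the (total) degree of the square-free part of `p`. -/
noncomputable def radDegree {σ : Type*} (p : MvPolynomial σ ℂ) : ℕ :=
  (squarefreePart p).totalDegree

/-- `gcd {f i | i ∈ s} = 1`: the only common divisors of the `f i`, `i ∈ s`, are the units. -/
def GcdEqOne {σ ι : Type*} (s : Finset ι) (f : ι → MvPolynomial σ ℂ) : Prop :=
  ∀ g : MvPolynomial σ ℂ, (∀ i ∈ s, g ∣ f i) → IsUnit g

/-- The square-free part, computed from any factorization into powers of pairwise
non-associated irreducible polynomials. -/
theorem squarefreePart_associated {σ ι : Type*} (s : Finset ι) (q : ι → MvPolynomial σ ℂ)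
    (e : ι → ℕ) (hq : ∀ i ∈ s, Irreducible (q i)) (he : ∀ i ∈ s, 1 ≤ e i)
    (hrel : ∀ i ∈ s, ∀ j ∈ s, i ≠ j → ¬ Associated (q i) (q j))
    (u p : MvPolynomial σ ℂ) (hu : IsUnit u) (hp : p = u * ∏ i ∈ s, q i ^ e i) :
    Associated (squarefreePart p) (∏ i ∈ s, q i) := by
  letI : StrongNormalizationMonoid (MvPolynomial σ ℂ) :=
    UniqueFactorizationMonoid.strongNormalizationMonoid
  have h1 : squarefreePart p = UniqueFactorizationMonoid.radical p := rfl
  rw [h1, hp, UniqueFactorizationMonoid.radical_mul_of_isUnit_left hu,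
    UniqueFactorizationMonoid.radical_prod]
  · refine Associated.prod s _ _ fun i hi => ?_
    rw [UniqueFactorizationMonoid.radical_pow_of_prime (hq i hi).prime
      (Nat.one_le_iff_ne_zero.mp (he i hi))]
    exact normalize_associated _
  · intro i hi j hj hij
    refine IsRelPrime.pow ?_
    rw [(hq i hi).isRelPrime_iff_not_dvd]
    exact fun h => hrel i hi j hj hij ((hq i hi).associated_of_dvd (hq j hj) h)

/-- `r(p)`, computed from any factorization into powers of pairwise non-associated irreducible
polynomials; in particular it does not depend on the choice of representatives. -/
theorem radDegree_eq {σ ι : Type*} (s : Finset ι) (q : ι → MvPolynomial σ ℂ)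
    (e : ι → ℕ) (hq : ∀ i ∈ s, Irreducible (q i)) (he : ∀ i ∈ s, 1 ≤ e i)
    (hrel : ∀ i ∈ s, ∀ j ∈ s, i ≠ j → ¬ Associated (q i) (q j))
    (u p : MvPolynomial σ ℂ) (hu : IsUnit u) (hp : p = u * ∏ i ∈ s, q i ^ e i) :
    radDegree p = (∏ i ∈ s, q i).totalDegree := by
  obtain ⟨v, hv⟩ := (squarefreePart_associated s q e hq he hrel u p hu hp).symm
  have h0 : (∏ i ∈ s, q i) ≠ 0 := Finset.prod_ne_zero_iff.mpr fun i hi => (hq i hi).ne_zero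
  have hd : (v : MvPolynomial σ ℂ).totalDegree = 0 := by
    have h := congrArg totalDegree v.mul_inv
    rw [totalDegree_mul_of_isDomain v.ne_zero v⁻¹.ne_zero, totalDegree_one] at h
    omega
  rw [radDegree, ← hv, totalDegree_mul_of_isDomain h0 v.ne_zero, hd, add_zero]

/-! Take `f m` of maximal degree and a minimal vanishing subsum over `I` containing `m`. Its gcd is
1, so it suffices to bound `deg f m - deg gcd` over `I` by `(|I| - 1).choose 2 * (deg ρ - 1)`, where
`ρ` is the square-free part of the product.

This bound is grown from a singleton. For a proper `A ⊂ I` the nonzero sum `-∑ i ∈ A, f i` is a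
combination, with nonzero coefficients, of independent `f j`, `j ∈ T ⊆ I \ A`. Passing to `A ∪ T`
costs `|T|.choose 2 * (deg ρ - 1)` (`totalDegree_sub_totalDegree_gcd_le`), and `choose 2` is
superadditive.

The cost comes from a nonzero generalized Wronskian of the `f j` (`exists_det_iterPDeriv_ne_zero`)
with `N ≤ |T|.choose 2` derivatives in all. They lower its degree by `N`, while a factor `ρ ^ N`
restores divisibility by the product of the columns' common factors. Replacing a column by the
combination only rescales the determinant, which brings in the gcd over `A`. -/

/-- The iterated partial derivative along a word of variables, the head being applied last. -/
noncomputable def iterPDeriv {σ : Type*} : List σ → MvPolynomial σ ℂ →ₗ[ℂ] MvPolynomial σ ℂ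
  | [] => LinearMap.id
  | k :: w => (pderiv k).toLinearMap ∘ₗ iterPDeriv w

@[simp] theorem iterPDeriv_nil {σ : Type*} (p : MvPolynomial σ ℂ) : iterPDeriv [] p = p := rfl

@[simp] theorem iterPDeriv_cons {σ : Type*} (k : σ) (w : List σ) (p : MvPolynomial σ ℂ) :
    iterPDeriv (k :: w) p = pderiv k (iterPDeriv w p) := rfl

/-! ### Divisibility of derivatives up to powers of `ρ`. -/

/-- If every irreducible factor of `h` divides `ρ`, then `h` divides `ρ * ∂h`. -/
theorem dvd_mul_pderiv_self {σ : Type*} {ρ h : MvPolynomial σ ℂ} (hh : h ≠ 0)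
    (hρ : ∀ p, Irreducible p → p ∣ h → p ∣ ρ) (k : σ) : h ∣ ρ * pderiv k h := by
  induction h using WfDvdMonoid.induction_on_irreducible with
  | zero => exact absurd rfl hh
  | unit u hu => exact hu.dvd
  | mul a i ha hi ih =>
    have h1 := ih ha fun p hp hpa => hρ p hp (hpa.mul_left _)
    obtain ⟨c, hc⟩ := hρ i hi (dvd_mul_right _ _)
    have : ρ * pderiv k (i * a) = i * a * (c * pderiv k i) + i * (ρ * pderiv k a) := by
      rw [pderiv_mul]
      linear_combination pderiv k i * a * hc
    rw [this]
    exact dvd_add (dvd_mul_right _ _) (mul_dvd_mul_left _ h1)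

/-- Each differentiation costs one factor `ρ`: differentiate `ρ ^ m * ∂u = h * q` and multiply by
`ρ`. The term with `∂h` is absorbed by `h ∣ ρ * ∂h`, and the one with `∂(ρ ^ m)` is again a multiple
of `ρ ^ m * ∂u`. -/
theorem dvd_pow_mul_iterPDeriv {σ : Type*} {ρ h u : MvPolynomial σ ℂ}
    (hρ : ∀ k, h ∣ ρ * pderiv k h) (hu : h ∣ u) (w : List σ) :
    h ∣ ρ ^ w.length * iterPDeriv w u := by
  induction w with
  | nil => simpa using hu
  | cons k w ih =>
    obtain ⟨q, hq⟩ := ih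
    obtain ⟨r, hr⟩ := hρ k
    have h1 := congrArg (pderiv k) hq
    rw [pderiv_mul, pderiv_mul, pderiv_pow] at h1
    rcases hw : w.length with _ | m
    · rw [hw] at h1
      simp only [Nat.cast_zero, zero_mul, pow_zero, one_mul, zero_add] at h1
      refine ⟨r * q + ρ * pderiv k q, ?_⟩
      simp only [List.length_cons, hw, iterPDeriv_cons, zero_add, pow_one]
      linear_combination ρ * h1 + q * hr
    · rw [hw] at h1 hq
      refine ⟨r * q + ρ * pderiv k q - (m + 1) * pderiv k ρ * q, ?_⟩
      simp only [List.length_cons, hw, iterPDeriv_cons]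
      simp only [Nat.cast_add, Nat.cast_one, Nat.add_sub_cancel] at h1
      linear_combination ρ * h1 + q * hr - (m + 1) * pderiv k ρ * hq

/-! ### Degree bounds in `ℤ`, where subtracting derivative orders is not truncated. -/

/-- `p` vanishes or has total degree at most `d`. -/
def TotalDegreeLE {σ : Type*} (p : MvPolynomial σ ℂ) (d : ℤ) : Prop :=
  ∀ m ∈ p.support, (m.degree : ℤ) ≤ d

theorem totalDegreeLE_totalDegree {σ : Type*} (p : MvPolynomial σ ℂ) :
    TotalDegreeLE p p.totalDegree := fun m hm => by
  have := le_totalDegree hm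
  rw [Finsupp.degree_apply]
  exact_mod_cast this

theorem TotalDegreeLE.mono {σ : Type*} {p : MvPolynomial σ ℂ} {d e : ℤ} (h : TotalDegreeLE p d)
    (hde : d ≤ e) : TotalDegreeLE p e := fun m hm => (h m hm).trans hde

theorem TotalDegreeLE.totalDegree_le {σ : Type*} {p : MvPolynomial σ ℂ} {d : ℤ}
    (h : TotalDegreeLE p d) (hp : p ≠ 0) : (p.totalDegree : ℤ) ≤ d := by
  obtain ⟨m, hm, he⟩ := Finset.exists_mem_eq_sup p.support (support_nonempty.mpr hp)
    (fun s => s.sum fun _ e => e)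
  have := h m hm
  rw [Finsupp.degree_apply] at this
  rw [totalDegree, he]
  exact_mod_cast this

theorem TotalDegreeLE.sum {σ ι : Type*} {s : Finset ι} {f : ι → MvPolynomial σ ℂ} {d : ℤ}
    (h : ∀ i ∈ s, TotalDegreeLE (f i) d) : TotalDegreeLE (∑ i ∈ s, f i) d := fun m hm => by
  classical
  obtain ⟨i, hi, him⟩ := Finset.mem_biUnion.mp (support_sum hm)
  exact h i hi m him

theorem TotalDegreeLE.mul {σ : Type*} {p q : MvPolynomial σ ℂ} {d e : ℤ}
    (hp : TotalDegreeLE p d) (hq : TotalDegreeLE q e) : TotalDegreeLE (p * q) (d + e) :=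
  fun m hm => by
  classical
  obtain ⟨a, ha, b, hb, rfl⟩ := Finset.mem_add.mp (support_mul p q hm)
  have := hp a ha
  have := hq b hb
  rw [map_add]
  push_cast
  linarith

theorem TotalDegreeLE.prod {σ ι : Type*} {s : Finset ι} {f : ι → MvPolynomial σ ℂ} {d : ι → ℤ}
    (h : ∀ i ∈ s, TotalDegreeLE (f i) (d i)) : TotalDegreeLE (∏ i ∈ s, f i) (∑ i ∈ s, d i) := by
  classical
  induction s using Finset.induction_on with
  | empty => simpa using totalDegreeLE_totalDegree (1 : MvPolynomial σ ℂ)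
  | insert a s ha ih =>
    rw [Finset.prod_insert ha, Finset.sum_insert ha]
    exact (h a (Finset.mem_insert_self a s)).mul
      (ih fun i hi => h i (Finset.mem_insert_of_mem hi))

theorem TotalDegreeLE.pderiv {σ : Type*} {p : MvPolynomial σ ℂ} {d : ℤ}
    (h : TotalDegreeLE p d) (k : σ) : TotalDegreeLE (pderiv k p) (d - 1) := fun m hm => by
  rw [mem_support_iff, coeff_pderiv] at hm
  have := h _ (mem_support_iff.mpr (left_ne_zero_of_mul hm))
  rw [map_add, Finsupp.degree_single] at this
  push_cast at this
  linarith

theorem TotalDegreeLE.iterPDeriv {σ : Type*} {p : MvPolynomial σ ℂ} {d : ℤ}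
    (h : TotalDegreeLE p d) (w : List σ) : TotalDegreeLE (iterPDeriv w p) (d - w.length) := by
  induction w with
  | nil => simpa using h
  | cons k w ih =>
    refine (ih.pderiv k).mono ?_
    simp only [List.length_cons]
    push_cast
    linarith

/-! ### Linear independence and generalized Wronskians. -/

theorem coeff_X_mul_pderiv {σ : Type*} (p : MvPolynomial σ ℂ) (k : σ) (m : σ →₀ ℕ) :
    coeff m (X k * pderiv k p) = m k * coeff m p := by
  classical
  rw [mul_comm, coeff_mul_X']
  split_ifs with hk
  · have h1 : 1 ≤ m k := Nat.one_le_iff_ne_zero.mpr (Finsupp.mem_support_iff.mp hk)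
    have h2 : m - Finsupp.single k 1 + Finsupp.single k 1 = m :=
      tsub_add_cancel_of_le (Finsupp.single_le_iff.mpr h1)
    rw [coeff_pderiv, h2, mul_comm]
    congr 1
    simp [Nat.cast_sub h1]
  · rw [Finsupp.notMem_support_iff.mp hk]
    simp

/-- Polynomials with the same logarithmic derivatives are proportional. -/
theorem exists_eq_smul_of_mul_pderiv_eq {σ : Type*} [Finite σ] {a b : MvPolynomial σ ℂ}
    (hb : b ≠ 0) (h : ∀ k, b * pderiv k a = a * pderiv k b) : ∃ c : ℂ, a = c • b := by
  classical
  let : LinearOrder σ := linearOrderOfSTO WellOrderingRel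
  let M : MonomialOrder σ := MonomialOrder.degLex
  set m := M.degree b
  have hbm : coeff m b ≠ 0 := M.coeff_degree_ne_zero_iff.mpr hb
  refine ⟨coeff m a / coeff m b, ?_⟩
  set c := coeff m a / coeff m b
  rw [← sub_eq_zero]
  by_contra ha
  -- By the choice of `c`, `a'` has coefficient zero at the leading exponent `m` of `b`; it remains
  -- to show that `m` is also its leading exponent.
  set a' := a - c • b
  have h' : ∀ k, b * pderiv k a' = a' * pderiv k b := fun k => by
    simp only [a', map_sub, Derivation.map_smul, mul_sub, sub_mul, h k, smul_mul_assoc,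
      mul_smul_comm]
  set m' := M.degree a'
  have ham : coeff m' a' ≠ 0 := M.coeff_degree_ne_zero_iff.mpr ha
  have hle : ∀ (p : MvPolynomial σ ℂ) (k : σ),
      M.toSyn (M.degree (X k * pderiv k p)) ≤ M.toSyn (M.degree p) := fun p k => by
    rw [M.degree_le_iff]
    intro u hu
    rw [mem_support_iff, coeff_X_mul_pderiv] at hu
    exact M.le_degree (mem_support_iff.mpr (right_ne_zero_of_mul hu))
  have hmm : m' = m := by
    ext k
    have h1 : b * (X k * pderiv k a') = a' * (X k * pderiv k b) := by
      linear_combination X k * h' k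
    -- `X k * ∂ₖ` multiplies the coefficient at an exponent by its `k`-th entry, so the top
    -- coefficients give `m' k = m k`.
    have h2 := congrArg (coeff (m + m')) h1
    rw [M.coeff_mul_of_add_of_degree_le le_rfl (hle a' k), add_comm m m',
      M.coeff_mul_of_add_of_degree_le le_rfl (hle b k), coeff_X_mul_pderiv,
      coeff_X_mul_pderiv] at h2
    have h3 : (coeff m b * coeff m' a') * ((m' k : ℂ) - m k) = 0 := by linear_combination h2
    have h4 := (mul_eq_zero.mp h3).resolve_left (mul_ne_zero hbm ham)
    exact_mod_cast sub_eq_zero.mp h4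
  apply ham
  rw [hmm]
  simp only [a', c, coeff_sub, coeff_smul, smul_eq_mul]
  field_simp
  ring

/-- A nonzero module of vectors of polynomials closed under partial derivatives contains
a nonzero multiple of a constant vector. -/
theorem exists_mul_C_mem_of_pderiv_mem {σ ι : Type*} [Finite σ] [Fintype ι]
    {S : Submodule (MvPolynomial σ ℂ) (ι → MvPolynomial σ ℂ)} (hne : S ≠ ⊥)
    (hS : ∀ c ∈ S, ∀ k, (fun i => pderiv k (c i)) ∈ S) :
    ∃ (b : MvPolynomial σ ℂ) (a : ι → ℂ), b ≠ 0 ∧ a ≠ 0 ∧ (fun i => b * C (a i)) ∈ S := by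
  classical
  let supp : (ι → MvPolynomial σ ℂ) → Finset ι := fun c => Finset.univ.filter fun i => c i ≠ 0
  obtain ⟨c, ⟨hcS, hc0⟩, hmin⟩ := (measure fun c => (supp c).card).wf.has_min
    {c | c ∈ S ∧ c ≠ 0} (Submodule.exists_mem_ne_zero_of_ne_bot hne)
  obtain ⟨i₀, hi₀⟩ := Function.ne_iff.mp hc0
  simp only [Pi.zero_apply] at hi₀
  have key : ∀ k i, c i₀ * pderiv k (c i) = c i * pderiv k (c i₀) := by
    intro k
    by_contra hk
    push Not at hk
    obtain ⟨i₁, hi₁⟩ := hk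
    -- `d` vanishes at `i₀` and wherever `c` does, contradicting the minimal support of `c`. Hence
    -- all ratios `c i / c i₀` have zero derivatives.
    let d : ι → MvPolynomial σ ℂ := c i₀ • (fun i => pderiv k (c i)) - pderiv k (c i₀) • c
    have hd : d ∈ S := S.sub_mem (S.smul_mem _ (hS c hcS k)) (S.smul_mem _ hcS)
    have hdi : ∀ i, d i = c i₀ * pderiv k (c i) - pderiv k (c i₀) * c i := fun i => rfl
    have hd0 : d ≠ 0 := by
      refine Function.ne_iff.mpr ⟨i₁, ?_⟩
      rw [hdi, Pi.zero_apply, sub_ne_zero, mul_comm (pderiv k _)]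
      exact hi₁
    refine hmin d ⟨hd, hd0⟩ (Finset.card_lt_card ?_)
    refine (Finset.ssubset_iff_of_subset fun i hi => ?_).mpr ⟨i₀, ?_, ?_⟩
    · simp only [supp, Finset.mem_filter, Finset.mem_univ, true_and, hdi] at hi ⊢
      intro h0
      apply hi
      simp [h0]
    · simpa [supp] using hi₀
    · simp only [supp, Finset.mem_filter, Finset.mem_univ, true_and, hdi, not_not]
      ring
  choose a ha using fun i => exists_eq_smul_of_mul_pderiv_eq (a := c i) hi₀ fun k => key k i
  have hca : c = fun i => c i₀ * C (a i) := by
    funext i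
    conv_lhs => rw [ha i]
    rw [smul_eq_C_mul, mul_comm]
  refine ⟨c i₀, a, hi₀, ?_, hca ▸ hcS⟩
  rintro rfl
  apply hi₀
  rw [hca]
  simp

/-- Linearly independent polynomials have a nonvanishing generalized Wronskian whose `i`-th row
consists of derivatives of order at most `i`. -/
theorem exists_det_iterPDeriv_ne_zero {σ : Type*} [Finite σ] {n : ℕ}
    {f : Fin n → MvPolynomial σ ℂ} (hf : LinearIndependent ℂ f) :
    ∃ θ : Fin n → List σ, (∀ i, (θ i).length ≤ i) ∧
      (Matrix.of fun i j => iterPDeriv (θ i) (f j)).det ≠ 0 := by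
  let K := FractionRing (MvPolynomial σ ℂ)
  let row : List σ → Fin n → K := fun w j => algebraMap _ K (iterPDeriv w (f j))
  have key : ∀ j ≤ n, ∃ θ : Fin j → List σ, (∀ i, (θ i).length ≤ i) ∧
      LinearIndependent K fun i => row (θ i) := by
    intro j
    induction j with
    | zero => exact fun _ => ⟨Fin.elim0, fun i => i.elim0, linearIndependent_empty_type⟩
    | succ j ih =>
      intro hj
      obtain ⟨θ, hθ, hli⟩ := ih (by omega)
      by_cases hw : ∃ w : List σ, w.length ≤ j ∧
          row w ∉ Submodule.span K (Set.range fun i => row (θ i))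
      · obtain ⟨w, hwj, hw⟩ := hw
        refine ⟨Fin.snoc θ w, fun i => ?_, ?_⟩
        · induction i using Fin.lastCases with
          | last => simpa using hwj
          | cast i => simpa using hθ i
        · have : (fun i => row ((Fin.snoc θ w : Fin (j + 1) → List σ) i)) =
              Fin.snoc (fun i => row (θ i)) (row w) := by
            funext i
            induction i using Fin.lastCases with
            | last => simp
            | cast i => simp
          rw [this, linearIndependent_finSnoc]
          exact ⟨hli, hw⟩
      -- If `j < n` rows span all derivatives of order at most `j`, the relations `c` among the
      -- columns form a nonzero module closed under `∂ₖ`. A constant relation up to a factor then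
      -- contradicts independence of `f`.
      · exfalso
        push Not at hw
        let φ : (Fin n → MvPolynomial σ ℂ) →ₗ[MvPolynomial σ ℂ] (Fin j → MvPolynomial σ ℂ) :=
          Matrix.mulVecLin (Matrix.of fun i l => iterPDeriv (θ i) (f l))
        have hφ : ∀ c, c ∈ LinearMap.ker φ ↔ ∀ i, ∑ l, iterPDeriv (θ i) (f l) * c l = 0 := by
          intro c
          rw [LinearMap.mem_ker, funext_iff]
          rfl
        have hker : LinearMap.ker φ ≠ ⊥ := fun h => by
          have := le_of_fin_injective _ φ (LinearMap.ker_eq_bot.mp h)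
          omega
        have hall : ∀ c ∈ LinearMap.ker φ, ∀ w : List σ, w.length ≤ j →
            ∑ l, iterPDeriv w (f l) * c l = 0 := by
          intro c hc w hwj
          let ψ : (Fin n → K) →ₗ[K] K :=
            Fintype.linearCombination K (fun l => algebraMap _ K (c l))
          have hψ : ∀ w, ψ (row w) = algebraMap _ K (∑ l, iterPDeriv w (f l) * c l) := by
            intro w
            simp [ψ, row, Fintype.linearCombination_apply]
          have h0 : Submodule.span K (Set.range fun i => row (θ i)) ≤ LinearMap.ker ψ := by
            rw [Submodule.span_le]
            rintro _ ⟨i, rfl⟩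
            rw [SetLike.mem_coe, LinearMap.mem_ker, hψ, (hφ c).mp hc i, map_zero]
          have h1 := h0 (hw w hwj)
          rw [LinearMap.mem_ker, hψ] at h1
          exact (map_eq_zero_iff _ (IsFractionRing.injective (MvPolynomial σ ℂ) K)).mp h1
        have hclosed : ∀ c ∈ LinearMap.ker φ, ∀ k, (fun i => pderiv k (c i)) ∈ LinearMap.ker φ := by
          intro c hc k
          rw [hφ]
          intro i
          have h1 := congrArg (pderiv k) ((hφ c).mp hc i)
          rw [map_sum, map_zero] at h1
          simp only [pderiv_mul, Finset.sum_add_distrib] at h1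
          -- The order is at most `i + 1 ≤ j`, so the term in which `f` is differentiated vanishes.
          have h2 := hall c hc (k :: θ i) (by
            have := hθ i
            have := i.2
            simp only [List.length_cons]
            omega)
          simp only [iterPDeriv_cons] at h2
          rwa [h2, zero_add] at h1
        obtain ⟨b, a, hb, ha, hmem⟩ := exists_mul_C_mem_of_pderiv_mem hker hclosed
        have h1 := hall _ hmem [] (by simp)
        have h2 : b * ∑ l, a l • f l = 0 := by
          rw [← h1, Finset.mul_sum]
          refine Finset.sum_congr rfl fun l _ => ?_
          rw [smul_eq_C_mul, iterPDeriv_nil]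
          ring
        exact ha (funext (Fintype.linearIndependent_iff.mp hf a
          ((mul_eq_zero.mp h2).resolve_left hb)))
  obtain ⟨θ, hθ, hli⟩ := key n le_rfl
  refine ⟨θ, hθ, fun h0 => ?_⟩
  have h1 : LinearIndependent K
      ((algebraMap (MvPolynomial σ ℂ) K).mapMatrix
        (Matrix.of fun i j => iterPDeriv (θ i) (f j))).row := hli
  rw [Matrix.linearIndependent_rows_iff_isUnit, Matrix.isUnit_iff_isUnit_det,
    ← RingHom.map_det, h0, map_zero] at h1
  exact not_isUnit_zero h1

/-! ### Divisibility and degree of the Wronskian, and the growth step. -/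

theorem prod_dvd_pow_mul_det_iterPDeriv {σ : Type*} {n : ℕ} {ρ : MvPolynomial σ ℂ}
    {h u : Fin n → MvPolynomial σ ℂ} (hρ : ∀ j k, h j ∣ ρ * pderiv k (h j)) (hu : ∀ j, h j ∣ u j)
    (θ : Fin n → List σ) :
    ∏ j, h j ∣ ρ ^ (∑ i, (θ i).length) * (Matrix.of fun i j => iterPDeriv (θ i) (u j)).det := by
  choose q hq using fun i j => dvd_pow_mul_iterPDeriv (hρ j) (hu j) (θ i)
  -- Row `i` receives `ρ ^ (θ i).length`; then `h j` factors out of column `j`.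
  rw [← Finset.prod_pow_eq_pow_sum, ← Matrix.det_mul_column]
  have : (Matrix.of fun i j => ρ ^ (θ i).length *
      (Matrix.of fun i j => iterPDeriv (θ i) (u j)) i j) =
      Matrix.of fun i j => h j * (Matrix.of q) i j := by
    ext1 i j
    exact hq i j
  rw [this, Matrix.det_mul_row]
  exact dvd_mul_right _ _

/-- Every term of the Leibniz expansion uses each row once, so all lose the same total order. -/
theorem totalDegreeLE_det_iterPDeriv {σ : Type*} {n : ℕ} {u : Fin n → MvPolynomial σ ℂ}
    {d : Fin n → ℤ} (hu : ∀ j, TotalDegreeLE (u j) (d j)) (θ : Fin n → List σ) :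
    TotalDegreeLE (Matrix.of fun i j => iterPDeriv (θ i) (u j)).det
      (∑ j, d j - (∑ i, (θ i).length : ℕ)) := by
  rw [Matrix.det_apply]
  refine TotalDegreeLE.sum fun π _ => ?_
  have h1 : TotalDegreeLE (∏ i, (Matrix.of fun i j => iterPDeriv (θ i) (u j)) (π i) i)
      (∑ i, (d i - (θ (π i)).length)) :=
    TotalDegreeLE.prod fun i _ => (hu i).iterPDeriv _
  rw [Finset.sum_sub_distrib, Equiv.sum_comp π fun i => ((θ i).length : ℤ)] at h1
  push_cast
  intro m hm
  refine h1 m ?_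
  rcases Int.units_eq_one_or (Equiv.Perm.sign π) with hs | hs <;> simpa [hs] using hm

theorem totalDegree_prod_of_ne_zero {σ ι : Type*} {s : Finset ι} {f : ι → MvPolynomial σ ℂ}
    (hf : ∀ i ∈ s, f i ≠ 0) : (∏ i ∈ s, f i).totalDegree = ∑ i ∈ s, (f i).totalDegree := by
  classical
  induction s using Finset.induction_on with
  | empty => simp
  | insert a s ha ih =>
    rw [Finset.forall_mem_insert] at hf
    rw [Finset.prod_insert ha, Finset.sum_insert ha,
      totalDegree_mul_of_isDomain hf.1 (Finset.prod_ne_zero_iff.mpr hf.2), ih hf.2]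

theorem sum_length_le_choose_two {α : Type*} {n : ℕ} {θ : Fin n → List α}
    (hθ : ∀ i, (θ i).length ≤ i) : ∑ i, (θ i).length ≤ n.choose 2 := by
  refine (Finset.sum_le_sum fun i _ => hθ i).trans ?_
  rw [Fin.sum_univ_eq_sum_range (fun i => i), Finset.sum_range_id, Nat.choose_two_right]

/-- Adjoining linearly independent polynomials `f i`, a combination `g` of which with nonzero
coefficients is divisible by `h` and has degree at most `D`, increases the difference between the
maximal degree and the degree of the greatest common divisor by at most
`n.choose 2 * (deg ρ - 1)`. -/
theorem totalDegree_sub_totalDegree_gcd_le {σ : Type*} [Finite σ]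
    [NormalizedGCDMonoid (MvPolynomial σ ℂ)] {n : ℕ} {ρ h : MvPolynomial σ ℂ}
    {f : Fin n → MvPolynomial σ ℂ} {c : Fin n → ℂ} {D : ℤ} (hρ1 : 1 ≤ ρ.totalDegree)
    (hf : LinearIndependent ℂ f) (hc : ∀ i, c i ≠ 0) (hh : h ≠ 0) (hhg : h ∣ ∑ i, c i • f i)
    (hD : TotalDegreeLE (∑ i, c i • f i) D)
    (hρh : ∀ k, h ∣ ρ * pderiv k h) (hρf : ∀ i k, f i ∣ ρ * pderiv k (f i)) {D' : ℤ}
    (hD' : D' = D ∨ ∃ i, D' = (f i).totalDegree) :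
    D' - (gcd h (Finset.univ.gcd f)).totalDegree ≤
      D - h.totalDegree + n.choose 2 * ((ρ.totalDegree : ℤ) - 1) := by
  obtain ⟨θ, hθ, hW⟩ := exists_det_iterPDeriv_ne_zero hf
  set W := (Matrix.of fun i j => iterPDeriv (θ i) (f j)).det with hWdef
  set N := ∑ i, (θ i).length
  have hN : N ≤ n.choose 2 := sum_length_le_choose_two hθ
  set g := ∑ i, c i • f i with hg
  have hupd : ∀ i, (Matrix.of fun a b => iterPDeriv (θ a) (Function.update f i g b)).det
      = C (c i) * W := by
    intro i
    have := Matrix.det_updateCol_sum (Matrix.of fun i j => iterPDeriv (θ i) (f j)) i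
      fun j => C (c j)
    rw [smul_eq_mul, ← hWdef] at this
    rw [← this]
    congr 1
    ext1 a b
    rcases eq_or_ne b i with rfl | hb
    · simp [hg, smul_eq_C_mul, map_sum]
      simp [← smul_eq_C_mul]
    · simp [hb]
  have hρ0 : ρ ≠ 0 := by
    rintro rfl
    simp at hρ1
  have hf0 : ∀ i, f i ≠ 0 := hf.ne_zero
  set X := ρ ^ N * W
  have hX : X ≠ 0 := mul_ne_zero (pow_ne_zero _ hρ0) hW
  set P := ∏ i, f i
  have hP : P ∣ X := prod_dvd_pow_mul_det_iterPDeriv hρf (fun _ => dvd_rfl) θ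
  -- With `g` in column `i`, the factor `h` replaces `f i` in the product dividing `X`.
  have hfX : ∀ i, h * P ∣ f i * X := by
    intro i
    have h1 : ∏ j, Function.update f i h j ∣
        ρ ^ N * (Matrix.of fun a b => iterPDeriv (θ a) (Function.update f i g b)).det := by
      refine prod_dvd_pow_mul_det_iterPDeriv (fun j k => ?_) (fun j => ?_) θ
      · rcases eq_or_ne j i with rfl | hj
        · simpa using hρh k
        · simpa [hj] using hρf j k
      · rcases eq_or_ne j i with rfl | hj
        · simpa using hhg
        · simp [hj]
    rw [hupd, Finset.prod_update_of_mem (Finset.mem_univ i)] at h1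
    have h2 : P = f i * ∏ j ∈ Finset.univ \ {i}, f j := by
      rw [← Finset.prod_update_of_mem (Finset.mem_univ i), Function.update_eq_self]
    have hu : IsUnit (C (c i) : MvPolynomial σ ℂ) := (Ne.isUnit (hc i)).map C
    rw [h2, show h * (f i * ∏ j ∈ Finset.univ \ {i}, f j) =
      f i * (h * ∏ j ∈ Finset.univ \ {i}, f j) by ring]
    refine mul_dvd_mul_left _ ?_
    rwa [mul_left_comm, hu.dvd_mul_left] at h1
  have hgcd : h * P ∣ gcd h (Finset.univ.gcd f) * X := by
    have h1 : h * P ∣ gcd (h * X) (Finset.univ.gcd f * X) :=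
      dvd_gcd (mul_dvd_mul_left _ hP) ((Finset.dvd_gcd fun i _ => hfX i).trans
        (Finset.gcd_mul_right' (f := f) (s := Finset.univ) X).dvd)
    exact h1.trans (gcd_mul_right' X h _).dvd
  have hg0 : gcd h (Finset.univ.gcd f) ≠ 0 := fun h0 => hh ((gcd_eq_zero_iff _ _).mp h0).1
  have hdeg := totalDegree_le_of_dvd_of_isDomain hgcd (mul_ne_zero hg0 hX)
  have hP0 : P ≠ 0 := Finset.prod_ne_zero_iff.mpr fun i _ => hf0 i
  rw [totalDegree_mul_of_isDomain hh hP0, totalDegree_mul_of_isDomain hg0 hX,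
    totalDegree_mul_of_isDomain (pow_ne_zero _ hρ0) hW] at hdeg
  have hpow : (ρ ^ N).totalDegree ≤ N * ρ.totalDegree := totalDegree_pow _ _
  have hPdeg : P.totalDegree = ∑ i, (f i).totalDegree :=
    totalDegree_prod_of_ne_zero fun i _ => hf0 i
  have hW1 : (W.totalDegree : ℤ) ≤ ∑ i, ((f i).totalDegree : ℤ) - N :=
    (totalDegreeLE_det_iterPDeriv (fun j => totalDegreeLE_totalDegree (f j)) θ).totalDegree_le hW
  -- For `D' = deg (f i)`, the degree is read off the determinant with `g` in column `i`.
  have hW2 : (W.totalDegree : ℤ) ≤ ∑ i, ((f i).totalDegree : ℤ) - N + (D - D') := by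
    rcases hD' with rfl | ⟨i, rfl⟩
    · simpa using hW1
    · have h1 : TotalDegreeLE (C (c i) * W)
          (∑ j, Function.update (fun j => ((f j).totalDegree : ℤ)) i D j - N) := by
        rw [← hupd]
        refine totalDegreeLE_det_iterPDeriv (fun j => ?_) θ
        rcases eq_or_ne j i with rfl | hj
        · simpa using hD
        · simpa [hj] using totalDegreeLE_totalDegree (f j)
      have hC0 : (C (c i) : MvPolynomial σ ℂ) ≠ 0 := by simpa using hc i
      have h2 := h1.totalDegree_le (mul_ne_zero hC0 hW)
      rw [totalDegree_mul_of_isDomain hC0 hW, totalDegree_C, zero_add,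
        Finset.sum_update_of_mem (Finset.mem_univ i)] at h2
      have h3 : ∑ j, ((f j).totalDegree : ℤ) =
          (f i).totalDegree + ∑ j ∈ Finset.univ \ {i}, ((f j).totalDegree : ℤ) := by
        rw [← Finset.sum_update_of_mem (Finset.mem_univ i)
          (fun j => ((f j).totalDegree : ℤ)), Function.update_eq_self]
      linarith
  have hmul : (N : ℤ) * ((ρ.totalDegree : ℤ) - 1) ≤ n.choose 2 * ((ρ.totalDegree : ℤ) - 1) :=
    mul_le_mul_of_nonneg_right (by exact_mod_cast hN) (by
      have : (1 : ℤ) ≤ ρ.totalDegree := by exact_mod_cast hρ1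
      linarith)
  rw [hPdeg] at hdeg
  zify at hdeg hpow
  linarith

/-! ### The inequality for minimal vanishing sums. -/

/-- A linear combination can be rewritten as one of a linearly independent subfamily, with
nonzero coefficients. -/
theorem exists_subset_linearIndepOn_sum_smul_eq {K V ι : Type*} [Field K] [AddCommGroup V]
    [Module K V] (v : ι → V) (B : Finset ι) (c : ι → K) :
    ∃ T ⊆ B, ∃ d : ι → K, (∀ i ∈ T, d i ≠ 0) ∧ ∑ i ∈ T, d i • v i = ∑ i ∈ B, c i • v i ∧
      LinearIndepOn K v (T : Set ι) := by
  classical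
  induction B using Finset.strongInduction generalizing c with
  | H B ih =>
    have herase : ∀ (c' : ι → K), ∀ i₀ ∈ B, c' i₀ = 0 →
        ∑ i ∈ B, c' i • v i = ∑ i ∈ B, c i • v i →
        ∃ T ⊆ B, ∃ d : ι → K, (∀ i ∈ T, d i ≠ 0) ∧ ∑ i ∈ T, d i • v i = ∑ i ∈ B, c i • v i ∧
          LinearIndepOn K v (T : Set ι) := by
      intro c' i₀ hi₀ h0 hc'
      obtain ⟨T, hT, d, hd, hsum, hli⟩ := ih (B.erase i₀) (Finset.erase_ssubset hi₀) c'
      refine ⟨T, hT.trans (Finset.erase_subset _ _), d, hd, ?_, hli⟩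
      rw [hsum, ← hc', ← Finset.add_sum_erase _ _ hi₀, h0, zero_smul, zero_add]
    by_cases hz : ∃ i ∈ B, c i = 0
    · obtain ⟨i₀, hi₀, h0⟩ := hz
      exact herase c i₀ hi₀ h0 rfl
    by_cases hli : LinearIndepOn K v (B : Set ι)
    · push Not at hz
      exact ⟨B, subset_rfl, c, hz, rfl, hli⟩
    rw [linearIndepOn_finset_iff] at hli
    push Not at hli
    obtain ⟨b, hb, i₀, hi₀, hbi⟩ := hli
    -- Subtracting a multiple of the relation `b` kills the coefficient at `i₀`.
    refine herase (fun i => c i - c i₀ / b i₀ * b i) i₀ hi₀ (by field_simp; ring) ?_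
    simp only [sub_smul, mul_smul, Finset.sum_sub_distrib, ← Finset.smul_sum, hb, smul_zero,
      sub_zero]

theorem choose_two_add_choose_two_le (a b : ℕ) : a.choose 2 + b.choose 2 ≤ (a + b).choose 2 := by
  induction b with
  | zero => simp
  | succ b ih =>
    have h1 : (b + 1).choose 2 = b + b.choose 2 := by
      rw [Nat.choose_succ_succ' b 1, Nat.choose_one_right]
    have h2 : (a + (b + 1)).choose 2 = a + b + (a + b).choose 2 := by
      rw [← add_assoc, Nat.choose_succ_succ' (a + b) 1, Nat.choose_one_right]
    omega

/-- The Brownawell–Masser inequality for sums of polynomials without vanishing proper subsums. -/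
theorem totalDegree_sub_totalDegree_gcd_le_of_minimal {σ ι : Type*} [Finite σ]
    [NormalizedGCDMonoid (MvPolynomial σ ℂ)] {ρ : MvPolynomial σ ℂ} {I : Finset ι}
    {f : ι → MvPolynomial σ ℂ} (hρ1 : 1 ≤ ρ.totalDegree) (hf0 : ∀ i ∈ I, f i ≠ 0)
    (hρ : ∀ i ∈ I, ∀ p, Irreducible p → p ∣ f i → p ∣ ρ)
    (hsum : ∑ i ∈ I, f i = 0)
    (hmin : ∀ A ⊂ I, A.Nonempty → ∑ i ∈ A, f i ≠ 0) :
    ∀ i ∈ I, ((f i).totalDegree : ℤ) - (I.gcd f).totalDegree ≤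
      (I.card - 1).choose 2 * ((ρ.totalDegree : ℤ) - 1) := by
  classical
  intro i hi
  let bdd : Finset ι → Prop := fun A => A.Nonempty ∧
    ∀ i ∈ A, ((f i).totalDegree : ℤ) - (A.gcd f).totalDegree ≤
      (A.card - 1).choose 2 * ((ρ.totalDegree : ℤ) - 1)
  have hstart : {i} ∈ I.powerset.filter bdd := by
    have h := associated_normalize (f i)
    have hd := totalDegree_le_of_dvd_of_isDomain h.dvd (by simpa using hf0 i hi)
    simp only [Finset.mem_filter, Finset.mem_powerset, Finset.singleton_subset_iff, hi, true_and,
      bdd, Finset.singleton_nonempty, Finset.mem_singleton, forall_eq, Finset.gcd_singleton,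
      Finset.card_singleton]
    simpa using hd
  obtain ⟨A, hA, hmax⟩ := Finset.exists_max_image (I.powerset.filter bdd) Finset.card ⟨_, hstart⟩
  simp only [Finset.mem_filter, Finset.mem_powerset, bdd] at hA
  obtain ⟨hAI, hAne, hAb⟩ := hA
  by_cases hAeq : A = I
  · subst hAeq
    exact hAb i hi
  exfalso
  have hAss : A ⊂ I := hAI.ssubset_of_ne hAeq
  have hB : ∑ i ∈ I \ A, f i = -∑ i ∈ A, f i := by
    rw [eq_neg_iff_add_eq_zero, Finset.sum_sdiff hAI, hsum]
  obtain ⟨T, hTB, c, hc, hTsum, hTli⟩ :=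
    exists_subset_linearIndepOn_sum_smul_eq f (I \ A) (fun _ => (1 : ℂ))
  simp only [one_smul] at hTsum
  rw [hB] at hTsum
  have hTne : T.Nonempty := by
    rw [Finset.nonempty_iff_ne_empty]
    rintro rfl
    exact hmin A hAss hAne (by simpa using hTsum.symm)
  have hTI : T ⊆ I := hTB.trans Finset.sdiff_subset
  have hdisj : Disjoint A T := (Finset.disjoint_sdiff (s := A) (t := I)).mono_right hTB
  let e := T.equivFin
  have hTimg : Finset.univ.image (fun j => (e.symm j : ι)) = T := by
    ext x
    simp only [Finset.mem_image, Finset.mem_univ, true_and]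
    exact ⟨fun ⟨j, hj⟩ => hj ▸ (e.symm j).2, fun hx => ⟨e ⟨x, hx⟩, by simp⟩⟩
  have hgcdT : Finset.univ.gcd (fun j => f (e.symm j)) = T.gcd f := by
    conv_rhs => rw [← hTimg]
    rw [Finset.gcd_image]
    rfl
  have hsumT : ∑ j, c (e.symm j) • f (e.symm j) = -∑ i ∈ A, f i := by
    rw [← hTsum, ← Finset.sum_coe_sort T, ← Equiv.sum_comp e.symm]
  have hg0 : A.gcd f ≠ 0 := by
    rw [Finset.gcd_ne_zero_iff]
    obtain ⟨a, ha⟩ := hAne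
    exact ⟨a, ha, hf0 a (hAI ha)⟩
  obtain ⟨a₀, ha₀, hsup⟩ := Finset.exists_mem_eq_sup A hAne fun i => (f i).totalDegree
  -- The two choices of `D'` cover the degrees over `A` and over `T`.
  have hstep : ∀ D' : ℤ, (D' = (A.sup fun i => (f i).totalDegree : ℕ) ∨
      ∃ j, D' = (f (e.symm j)).totalDegree) →
      D' - ((A ∪ T).gcd f).totalDegree ≤
        ((A ∪ T).card - 1).choose 2 * ((ρ.totalDegree : ℤ) - 1) := by
    intro D' hD'
    have h1 := totalDegree_sub_totalDegree_gcd_le (h := A.gcd f) (ρ := ρ)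
      (f := fun j => f (e.symm j)) (c := fun j => c (e.symm j))
      (D := (A.sup fun i => (f i).totalDegree : ℕ)) hρ1
      (LinearIndependent.comp hTli e.symm e.symm.injective) (fun j => hc _ (e.symm j).2) hg0
      (by
        rw [hsumT, dvd_neg]
        exact Finset.dvd_sum fun i hi => Finset.gcd_dvd hi)
      (by
        rw [hsumT]
        refine (totalDegreeLE_totalDegree _).mono ?_
        rw [totalDegree_neg]
        exact_mod_cast totalDegree_finsetSum A f)
      (dvd_mul_pderiv_self hg0 fun p hp hpg =>
        hρ a₀ (hAI ha₀) p hp (hpg.trans (Finset.gcd_dvd ha₀)))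
      (fun j => dvd_mul_pderiv_self (hf0 _ (hTI (e.symm j).2)) (hρ _ (hTI (e.symm j).2))) hD'
    rw [hgcdT, ← Finset.gcd_union, hsup] at h1
    have h2 := hAb a₀ ha₀
    have hcard : (A ∪ T).card - 1 = A.card - 1 + T.card := by
      rw [Finset.card_union_of_disjoint hdisj]
      have := hAne.card_pos
      omega
    have h3 := choose_two_add_choose_two_le (A.card - 1) T.card
    rw [hcard]
    have h4 : (1 : ℤ) ≤ ρ.totalDegree := by exact_mod_cast hρ1
    zify at h3
    nlinarith [mul_le_mul_of_nonneg_right h3 (sub_nonneg.mpr h4)]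
  have hU : A ∪ T ∈ I.powerset.filter bdd := by
    simp only [Finset.mem_filter, Finset.mem_powerset, bdd]
    refine ⟨Finset.union_subset hAI hTI, hAne.mono Finset.subset_union_left, fun i hi => ?_⟩
    rcases Finset.mem_union.mp hi with hi | hi
    · refine le_trans ?_ (hstep _ (Or.inl rfl))
      have : (f i).totalDegree ≤ A.sup fun i => (f i).totalDegree :=
        Finset.le_sup (f := fun i => (f i).totalDegree) hi
      zify at this
      linarith
    · exact hstep _ (Or.inr ⟨e ⟨i, hi⟩, by simp⟩)
  have h1 := hmax _ hU
  rw [Finset.card_union_of_disjoint hdisj] at h1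
  have := hTne.card_pos
  omega

/-! ### The square-free part and the final deduction. -/

theorem dvd_squarefreePart {σ : Type*} {p q : MvPolynomial σ ℂ} (hp : Irreducible p) (hq : q ≠ 0)
    (hpq : p ∣ q) : p ∣ squarefreePart q := by
  let : StrongNormalizationMonoid (MvPolynomial σ ℂ) :=
    UniqueFactorizationMonoid.strongNormalizationMonoid
  exact (UniqueFactorizationMonoid.dvd_radical_iff_of_irreducible hp hq).mpr hpq

theorem squarefreePart_ne_zero {σ : Type*} (q : MvPolynomial σ ℂ) : squarefreePart q ≠ 0 := by
  let : StrongNormalizationMonoid (MvPolynomial σ ℂ) :=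
    UniqueFactorizationMonoid.strongNormalizationMonoid
  exact UniqueFactorizationMonoid.radical_ne_zero

theorem one_le_radDegree {σ : Type*} {q : MvPolynomial σ ℂ} (hq : q ≠ 0)
    (hqu : ¬ IsUnit q) : 1 ≤ radDegree q := by
  obtain ⟨p, hp, hpq⟩ := WfDvdMonoid.exists_irreducible_factor hqu hq
  have h1 := totalDegree_le_of_dvd_of_isDomain (dvd_squarefreePart hp hq hpq)
    (squarefreePart_ne_zero q)
  refine le_trans (Nat.one_le_iff_ne_zero.mpr fun h0 => hp.not_isUnit ?_) h1
  rw [totalDegree_eq_zero_iff_eq_C] at h0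
  rw [h0]
  refine IsUnit.map C (Ne.isUnit fun h => hp.ne_zero ?_)
  rw [h0, h, C_0]

/-- Every index of a vanishing sum lies in a vanishing subsum without vanishing proper subsums. -/
theorem exists_minimal_vanishing_subsum {M ι : Type*} [AddCommGroup M] {f : ι → M} {S : Finset ι}
    (hS : ∑ i ∈ S, f i = 0) {m : ι} (hm : m ∈ S) :
    ∃ I ⊆ S, m ∈ I ∧ ∑ i ∈ I, f i = 0 ∧ ∀ A ⊂ I, A.Nonempty → ∑ i ∈ A, f i ≠ 0 := by
  classical
  induction S using Finset.strongInduction with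
  | H S ih =>
    by_cases h : ∀ A ⊂ S, A.Nonempty → ∑ i ∈ A, f i ≠ 0
    · exact ⟨S, subset_rfl, hm, hS, h⟩
    push Not at h
    obtain ⟨A, hA, hAne, hA0⟩ := h
    by_cases hmA : m ∈ A
    · obtain ⟨I, hI, h⟩ := ih A hA hA0 hmA
      exact ⟨I, hI.trans hA.subset, h⟩
    · obtain ⟨I, hI, h⟩ := ih (S \ A) (Finset.sdiff_ssubset hA.subset hAne)
        (by rw [Finset.sum_sdiff_eq_sub hA.subset, hS, hA0, sub_zero])
        (Finset.mem_sdiff.mpr ⟨hm, hmA⟩)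
      exact ⟨I, hI.trans Finset.sdiff_subset, h⟩

theorem mainTheorem5 {σ : Type*} [Finite σ] (n : ℕ) (hn : 3 ≤ n)
    (f : Fin n → MvPolynomial σ ℂ)
    (hconst : ¬ ∀ i, ∃ c : ℂ, f i = MvPolynomial.C c)
    (hsum : ∑ i, f i = 0)
    (hgcd : ∀ s : Finset (Fin n), s.Nonempty → ∑ i ∈ s, f i = 0 → GcdEqOne s f) :
    ((Finset.univ.sup fun m => (f m).totalDegree : ℕ) : ℝ) ≤
      ((n : ℝ) - 1) * ((n : ℝ) - 2) / 2 * ((radDegree (∏ i, f i) : ℝ) - 1) := by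
  classical
  let : NormalizationMonoid (MvPolynomial σ ℂ) :=
    UniqueFactorizationMonoid.strongNormalizationMonoid.toNormalizationMonoid
  let : NormalizedGCDMonoid (MvPolynomial σ ℂ) :=
    UniqueFactorizationMonoid.toNormalizedGCDMonoid _
  have hf0 : ∀ i, f i ≠ 0 := fun i hi => not_isUnit_zero (M₀ := MvPolynomial σ ℂ)
    (hgcd {i} (Finset.singleton_nonempty i) (by simpa using hi) 0 (by simpa using hi))
  have hP0 : ∏ i, f i ≠ 0 := Finset.prod_ne_zero_iff.mpr fun i _ => hf0 i
  have hr : 1 ≤ radDegree (∏ i, f i) := by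
    refine one_le_radDegree hP0 fun hu => hconst fun i => ?_
    have h1 := isUnit_of_dvd_unit (Finset.dvd_prod_of_mem f (Finset.mem_univ i)) hu
    exact ⟨_, (isUnit_iff_eq_C_of_isReduced.mp h1).choose_spec.2⟩
  obtain ⟨m, -, hm⟩ := Finset.exists_mem_eq_sup Finset.univ
    (⟨⟨0, by omega⟩, Finset.mem_univ _⟩ : (Finset.univ : Finset (Fin n)).Nonempty)
    fun m => (f m).totalDegree
  obtain ⟨I, -, hmI, hI0, hImin⟩ := exists_minimal_vanishing_subsum hsum (Finset.mem_univ m)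
  have hmain := totalDegree_sub_totalDegree_gcd_le_of_minimal (ρ := squarefreePart (∏ i, f i)) hr
    (fun i _ => hf0 i)
    (fun i _ p hp hpi => dvd_squarefreePart hp hP0
      (hpi.trans (Finset.dvd_prod_of_mem f (Finset.mem_univ i)))) hI0 hImin m hmI
  have hunit := hgcd I ⟨m, hmI⟩ hI0 (I.gcd f) fun i hi => Finset.gcd_dvd hi
  rw [(isUnit_iff_totalDegree_of_isReduced.mp hunit).2, Nat.cast_zero, sub_zero] at hmain
  -- Enlarging `|I|` to `n` only weakens the bound, since `radDegree (∏ i, f i) - 1` is nonnegative.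
  have hcard : (I.card - 1).choose 2 ≤ (n - 1).choose 2 :=
    Nat.choose_le_choose 2 (Nat.sub_le_sub_right (by simpa using I.card_le_univ) 1)
  have hfin : ((f m).totalDegree : ℤ) ≤
      (n - 1).choose 2 * ((radDegree (∏ i, f i) : ℤ) - 1) := by
    have h1 : (1 : ℤ) ≤ radDegree (∏ i, f i) := by exact_mod_cast hr
    refine le_trans ?_ (mul_le_mul_of_nonneg_right (Nat.cast_le.mpr hcard) (sub_nonneg.mpr h1))
    exact hmain
  have hreal : (((f m).totalDegree : ℤ) : ℝ) ≤
      (((n - 1).choose 2 * ((radDegree (∏ i, f i) : ℤ) - 1) : ℤ) : ℝ) := by exact_mod_cast hfin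
  push_cast [Nat.cast_choose_two, Nat.cast_sub (show 1 ≤ n by omega)] at hreal
  rw [hm]
  convert hreal using 3
  ring
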